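/- Let $L \ge 2$ be an integer and let $S = (d, N_1, \dots, N_L)$ be a neural network architecture with $L$ layers, where $N_0 := d, N_1, \dots, N_L$ are positive integers. A neural network with architecture $S$ is a family $\Phi = ((A_\ell, b_\ell))_{\ell=1}^L$ with $A_\ell \in \mathbb{R}^{N_\ell \times N_{\ell-1}}$ and $b_\ell \in \mathbb{R}^{N_\ell}$. For $\varrho : \mathbb{R} \to \mathbb{R}$ and $\Omega \subset \mathbb{R}^d$, its realization is the function $\mathrm{R}_\varrho^\Omega(\Phi) : \Omega \to \mathbb{R}^{N_L}$, $x \mapsto x_L$, where $x_0 := x$, $x_\ell := \varrho(A_\ell x_{\ell-1} + b_\ell)$ for $\ell = 1, \dots, L-1$ (with $\varrho$ acting componentwise), and $x_L := A_L x_{L-1} + b_L$. Let $\mathcal{RNN}_\varrho^\Omega(S)$ be the set of realizations $\mathrm{R}_\varrho^\Omega(\Phi)$ of all networks $\Phi$ with architecture $S$, a subset of the real vector space of functions $\Omega \to \mathbb{R}^{N_L}$. Theorem. Let $\Omega \subset \mathbb{R}^d$ have non-empty interior and let $\varrho : \mathbb{R} \to \mathbb{R}$ be locally Lipschitz continuous.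 If $\mathcal{RNN}_\varrho^\Omega(S)$ is convex, then $\varrho$ is a polynomial. -/

import Mathlib

/-- `NeuralNetwork N` is the set of neural networks with architecture
`(N 0, N 1, …, N L)`: families of `L` pairs, the pair with index `ℓ : Fin L` being the weight matrix
(of size `N (ℓ + 1) × N ℓ`) and the bias vector (of length `N (ℓ + 1)`) of the layer number `ℓ + 1`.
-/
abbrev NeuralNetwork {L : ℕ} (N : Fin (L + 1) → ℕ) : Type :=
  (ℓ : Fin L) →
    Matrix (Fin (N ℓ.succ)) (Fin (N ℓ.castSucc)) ℝ × (Fin (N ℓ.succ) → ℝ)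

namespace NeuralNetwork

variable {L : ℕ} {N : Fin (L + 1) → ℕ}

/-- The output of the layer with index `ℓ` for an input `v` from the previous layer:
the affine map `v ↦ A v + b`, followed by the componentwise activation `ρ`
except in the last layer. -/
def layer (ρ : ℝ → ℝ) (Φ : NeuralNetwork N) (ℓ : Fin L) (v : Fin (N ℓ.castSucc) → ℝ) :
    Fin (N ℓ.succ) → ℝ := fun i =>
  if (ℓ : ℕ) + 1 < L then ρ (((Φ ℓ).1.mulVec v + (Φ ℓ).2) i)
  else ((Φ ℓ).1.mulVec v + (Φ ℓ).2) i

/-- The vectors `x₀ = x, x₁, …, x_L` computed successively by the network. -/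
def states (ρ : ℝ → ℝ) (Φ : NeuralNetwork N) (x : Fin (N 0) → ℝ) :
    (ℓ : Fin (L + 1)) → Fin (N ℓ) → ℝ :=
  Fin.induction (motive := fun ℓ => Fin (N ℓ) → ℝ) x (fun ℓ v => layer ρ Φ ℓ v)

/-- The realization of a network, `Ω → ℝ ^ N_L`, `x ↦ x_L`. -/
def realization (ρ : ℝ → ℝ) (Ω : Set (Fin (N 0) → ℝ)) (Φ : NeuralNetwork N) :
    Ω → (Fin (N (Fin.last L)) → ℝ) :=
  fun x => states ρ Φ x.1 (Fin.last L)

end NeuralNetwork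

/-- The set of realizations of all networks with architecture `N`, activation function `ρ` and
domain `Ω`, inside the real vector space of functions `Ω → ℝ ^ N_L` with pointwise operations. -/
def realizationSet {L : ℕ} (N : Fin (L + 1) → ℕ) (ρ : ℝ → ℝ) (Ω : Set (Fin (N 0) → ℝ)) :
    Set (Ω → (Fin (N (Fin.last L)) → ℝ)) :=
  Set.range fun Φ : NeuralNetwork N => NeuralNetwork.realization ρ Ω Φ

/-! Scaling the last layer shows that realizations are closed under scalar multiplication, so a
convex set of them is a linear space. Restricted to a finite sample, one output coordinate gives a
space that is a locally Lipschitz image of parameter space; by Hausdorff dimension, its dimension is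
at most the number of parameters. Hence the space `A` of these coordinate functions is
finite-dimensional, so closed under pointwise limits. If `ρ` is not constant, it has a nonzero
derivative somewhere, and rescaled neurons there approximate the identity. Collapsing the hidden
layers in this way puts every `ρ (a * x j + b)` in `A`. On the line, such functions span a
finite-dimensional space invariant under translations and dilations. Dilations conjugate all nonzero
translations, and letting the shift tend to `0` shows that translations are unipotent. Thus high
differences of `ρ` vanish, and Fréchet's theorem applies. -/

/-- A space of functions whose restrictions to finite sets have bounded dimension is
finite-dimensional. -/
theorem finiteDimensional_of_finrank_restrict_le {X : Type*} (E : Submodule ℝ (X → ℝ)) (M : ℕ)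
    (h : ∀ s : Finset X,
      Module.finrank ℝ (E.map (LinearMap.funLeft ℝ ℝ (Subtype.val : s → X))) ≤ M) :
    FiniteDimensional ℝ E := by
  classical
  let r (s : Finset X) : E →ₗ[ℝ] (s → ℝ) :=
    (LinearMap.funLeft ℝ ℝ (Subtype.val : s → X)).domRestrict E
  have hr (s : Finset X) : Module.finrank ℝ (LinearMap.range (r s)) ≤ M := by
    exact (congrArg (fun W : Submodule ℝ (s → ℝ) => Module.finrank ℝ W)
      (LinearMap.range_domRestrict E _)).trans_le (h s)
  let d (s : Finset X) : ℕ := M - Module.finrank ℝ (LinearMap.range (r s))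
  -- A minimal defect means a restriction of maximal rank. If `f` vanished on `s` but not at `x`,
  -- adding `x` would raise the rank.
  let s := Function.argmin d
  have hs (t : Finset X) : d s ≤ d t := Function.argmin_le d t
  suffices hinj : Function.Injective (r s) from FiniteDimensional.of_injective (r s) hinj
  rw [← LinearMap.ker_eq_bot, LinearMap.ker_eq_bot']
  intro f hf
  by_contra hne
  obtain ⟨x, hx⟩ : ∃ x, (f : X → ℝ) x ≠ 0 := by
    by_contra! hzero
    exact hne (Subtype.ext (funext hzero))
  let t := insert x s
  let p : (t → ℝ) →ₗ[ℝ] (s → ℝ) :=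
    LinearMap.funLeft ℝ ℝ fun y : s => (⟨y, Finset.mem_insert_of_mem y.2⟩ : t)
  let q := p.domRestrict (LinearMap.range (r t))
  have hq : LinearMap.range q = LinearMap.range (r s) := by
    rw [LinearMap.range_domRestrict, ← LinearMap.range_comp]
    rfl
  have hne_bot : LinearMap.ker q ≠ ⊥ := by
    refine (Submodule.ne_bot_iff _).2 ⟨⟨r t f, f, rfl⟩, hf, fun h0 => hx ?_⟩
    exact congrFun (congrArg Subtype.val h0) ⟨x, Finset.mem_insert_self x s⟩
  have hker : 1 ≤ Module.finrank ℝ (LinearMap.ker q) := Submodule.one_le_finrank_iff.2 hne_bot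
  have hsum := q.finrank_range_add_finrank_ker
  rw [hq] at hsum
  have h1 := hs t
  have h2 := hr t
  have h3 := hr s
  simp only [d] at h1
  omega

/-! ### Vanishing differences and polynomials -/

/-- The values along an arithmetic progression of a function with vanishing iterated differences
are those of a polynomial. -/
theorem exists_polynomial_of_fwdDiff_iter_eq_zero {f : ℝ → ℝ} {M : ℕ} {h : ℝ} (hh : h ≠ 0)
    (hf : (fwdDiff h)^[M] f = 0) (y : ℝ) :
    ∃ p : Polynomial ℝ, ∀ n : ℕ, f (y + n * h) = p.eval (n * h) := by
  have hf' : ∀ k, M ≤ k → (fwdDiff h)^[k] f = 0 := by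
    intro k hk
    obtain ⟨j, rfl⟩ := Nat.exists_eq_add_of_le' hk
    rw [Function.iterate_add_apply, hf]
    clear hk
    induction j with
    | zero => rfl
    | succ j ih => rw [Function.iterate_succ_apply', ih]; ext; simp [fwdDiff]
  -- This is Newton's forward difference formula, truncated at order `M`.
  refine ⟨∑ k ∈ Finset.range M, Polynomial.C ((fwdDiff h)^[k] f y / (k.factorial : ℝ)) *
    (descPochhammer ℝ k).comp (Polynomial.C h⁻¹ * Polynomial.X), fun n => ?_⟩
  have h1 := shift_eq_sum_fwdDiff_iter h f n y
  rw [nsmul_eq_mul] at h1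
  rw [h1, Polynomial.eval_finsetSum]
  have h2 : ∑ k ∈ Finset.range (n + 1), n.choose k • (fwdDiff h)^[k] f y =
      ∑ k ∈ Finset.range (n + 1 + M), n.choose k • (fwdDiff h)^[k] f y := by
    refine Finset.sum_subset (Finset.range_mono (by omega)) fun k _ hk => ?_
    rw [Nat.choose_eq_zero_of_lt (by simpa using hk), zero_smul]
  have h3 : ∑ k ∈ Finset.range M, n.choose k • (fwdDiff h)^[k] f y =
      ∑ k ∈ Finset.range (n + 1 + M), n.choose k • (fwdDiff h)^[k] f y := by
    refine Finset.sum_subset (Finset.range_mono (by omega)) fun k _ hk => ?_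
    rw [hf' k (by simpa using hk), Pi.zero_apply, smul_zero]
  rw [h2, ← h3]
  refine Finset.sum_congr rfl fun k _ => ?_
  have h4 : h⁻¹ * (n * h) = n := by field_simp
  rw [Polynomial.eval_mul, Polynomial.eval_C, Polynomial.eval_comp, Polynomial.eval_mul,
    Polynomial.eval_C, Polynomial.eval_X, h4, nsmul_eq_mul, Nat.cast_choose_eq_descPochhammer_div]
  ring

/-- Fréchet's theorem: a continuous function on `ℝ` whose `M`-th differences all vanish is a
polynomial. -/
theorem Continuous.exists_polynomial_of_fwdDiff_iter_eq_zero {f : ℝ → ℝ} (hc : Continuous f)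
    {M : ℕ} (hf : ∀ h : ℝ, (fwdDiff h)^[M] f = 0) :
    ∃ p : Polynomial ℝ, ∀ x, f x = p.eval x := by
  have hinf : (Set.range ((↑) : ℕ → ℝ)).Infinite :=
    Set.infinite_range_of_injective Nat.cast_injective
  have half (y : ℝ) : ∃ p : Polynomial ℝ, ∀ x, 0 ≤ x → f (y + x) = p.eval x := by
    obtain ⟨P, hP⟩ := _root_.exists_polynomial_of_fwdDiff_iter_eq_zero one_ne_zero (hf 1) y
    simp only [mul_one] at hP
    refine ⟨P, fun x hx => ?_⟩
    -- The absolute value turns a claim on the half-line into one on all of `ℝ`, where density of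
    -- the rationals applies.
    have key : (fun x : ℝ => f (y + |x|)) = fun x => P.eval |x| := by
      refine Rat.denseRange_cast.equalizer (by fun_prop) (by fun_prop) (funext fun q => ?_)
      have hd : (q.den : ℝ) ≠ 0 := by exact_mod_cast q.den_nz
      obtain ⟨p, hp⟩ := _root_.exists_polynomial_of_fwdDiff_iter_eq_zero (inv_ne_zero hd) (hf _) y
      have hpP : p = P := by
        refine Polynomial.eq_of_infinite_eval_eq _ _ (hinf.mono ?_)
        rintro _ ⟨m, rfl⟩
        have h1 := hp (m * q.den)
        rw [Nat.cast_mul, mul_inv_cancel_right₀ hd, hP] at h1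
        exact h1.symm
      have hq : |(q : ℝ)| = (q.num.natAbs : ℝ) * (q.den : ℝ)⁻¹ := by
        rw [Nat.cast_natAbs, Int.cast_abs, ← div_eq_mul_inv]
        conv_lhs => rw [Rat.cast_def, abs_div, Nat.abs_cast]
      simp only [Function.comp_apply, hq]
      rw [hp, hpP]
    simpa [abs_of_nonneg hx] using congrFun key x
  have half' (K : ℕ) : ∃ p : Polynomial ℝ, ∀ x, -(K : ℝ) ≤ x → f x = p.eval x := by
    obtain ⟨p, hp⟩ := half (-K)
    refine ⟨p.comp (Polynomial.X + Polynomial.C (K : ℝ)), fun x hx => ?_⟩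
    have := hp (x + K) (by linarith)
    rw [Polynomial.eval_comp]
    simpa using this
  choose p hp using half'
  have hpe (K : ℕ) : p K = p 0 := by
    refine Polynomial.eq_of_infinite_eval_eq _ _ (hinf.mono ?_)
    rintro _ ⟨m, rfl⟩
    have hm : (0 : ℝ) ≤ m := m.cast_nonneg
    have hK : (0 : ℝ) ≤ K := K.cast_nonneg
    exact (hp K m (by linarith)).symm.trans (hp 0 m (by simp))
  refine ⟨p 0, fun x => ?_⟩
  obtain ⟨K, hK⟩ := exists_nat_ge (-x)
  rw [hp K x (by linarith), hpe]

/-! ### Locally Lipschitz maps -/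

/-- A nonconstant locally Lipschitz function has a nonzero derivative somewhere. -/
theorem LocallyLipschitz.exists_deriv_ne_zero {ρ : ℝ → ℝ} (hρ : LocallyLipschitz ρ) {a b : ℝ}
    (hab : ρ a ≠ ρ b) : ∃ x, deriv ρ x ≠ 0 := by
  by_contra! h
  obtain ⟨K, hK⟩ := (hρ.locallyLipschitzOn (s := Set.uIcc a b)).exists_lipschitzOnWith_of_compact
    isCompact_uIcc
  have := hK.absolutelyContinuousOnInterval.integral_deriv_eq_sub
  simp only [h, intervalIntegral.integral_zero] at this
  exact hab (by linarith)

theorem LocallyLipschitz.pi {X ι : Type*} [Fintype ι] [PseudoEMetricSpace X] {Y : ι → Type*}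
    [∀ i, PseudoEMetricSpace (Y i)] {f : X → ∀ i, Y i}
    (hf : ∀ i, LocallyLipschitz fun x => f x i) : LocallyLipschitz f := by
  intro x
  choose K t ht hK using fun i => hf i x
  refine ⟨Finset.univ.sup K, ⋂ i, t i, Filter.iInter_mem.2 ht, fun y hy z hz => ?_⟩
  refine edist_pi_le_iff.2 fun i => (hK i (Set.mem_iInter.1 hy i) (Set.mem_iInter.1 hz i)).trans ?_
  gcongr
  exact Finset.le_sup (Finset.mem_univ i)

/-- The dimension of a subspace parametrized by a locally Lipschitz map is at most the dimension of
the parameter space. -/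
theorem LocallyLipschitz.finrank_le_of_range_eq {P F : Type*} [NormedAddCommGroup P]
    [NormedSpace ℝ P] [FiniteDimensional ℝ P] [NormedAddCommGroup F] [NormedSpace ℝ F]
    [FiniteDimensional ℝ F] {g : P → F} (hg : LocallyLipschitz g) {W : Submodule ℝ F}
    (hW : Set.range g = W) : Module.finrank ℝ W ≤ Module.finrank ℝ P := by
  have : SecondCountableTopology P := by
    have := FiniteDimensional.proper_real P
    infer_instance
  have h1 : dimH (Set.range g) ≤ dimH (Set.univ : Set P) :=
    dimH_range_le_of_locally_lipschitzOn hg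
  have h2 : dimH (W : Set F) = Module.finrank ℝ W := by
    have h3 := W.subtypeₗᵢ.isometry.dimH_image Set.univ
    rw [Set.image_univ, Real.dimH_univ_eq_finrank] at h3
    simpa using h3
  rw [hW, h2, Real.dimH_univ_eq_finrank] at h1
  exact_mod_cast h1

/-! ### Translations and dilations on a finite-dimensional function space -/

section InvariantSpace

variable {E : Submodule ℝ (ℝ → ℝ)}

/-- Translation by `h` on a translation-invariant space of functions. -/
noncomputable def translation (hT : ∀ h : ℝ, ∀ f ∈ E, (fun x => f (x + h)) ∈ E) (h : ℝ) :
    Module.End ℝ E :=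
  (LinearMap.funLeft ℝ ℝ fun x : ℝ => x + h).restrict (hT h)

/-- Dilation by `a ≠ 0` on a dilation-invariant space of functions. -/
noncomputable def dilation (hS : ∀ a : ℝ, a ≠ 0 → ∀ f ∈ E, (fun x => f (a * x)) ∈ E) (a : ℝ)
    (ha : a ≠ 0) : Module.End ℝ E :=
  (LinearMap.funLeft ℝ ℝ fun x : ℝ => a * x).restrict (hS a ha)

variable (hT : ∀ h : ℝ, ∀ f ∈ E, (fun x => f (x + h)) ∈ E)

theorem translation_apply (h : ℝ) (f : E) (x : ℝ) :
    (translation hT h f : ℝ → ℝ) x = (f : ℝ → ℝ) (x + h) := rfl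

theorem dilation_apply (hS : ∀ a : ℝ, a ≠ 0 → ∀ f ∈ E, (fun x => f (a * x)) ∈ E)
    (a : ℝ) (ha : a ≠ 0) (f : E) (x : ℝ) :
    (dilation hS a ha f : ℝ → ℝ) x = (f : ℝ → ℝ) (a * x) := rfl

theorem translation_sub_one_pow_apply (h : ℝ) (n : ℕ) (f : E) :
    (((translation hT h - 1) ^ n) f : ℝ → ℝ) = (fwdDiff h)^[n] (f : ℝ → ℝ) := by
  induction n with
  | zero => rfl
  | succ n ih =>
    rw [pow_succ', Function.iterate_succ_apply', ← ih]
    rfl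

/-- Dilation by `h` conjugates translation by `h` into translation by `1`. -/
theorem det_translation_eq (hS : ∀ a : ℝ, a ≠ 0 → ∀ f ∈ E, (fun x => f (a * x)) ∈ E)
    (s h : ℝ) (hh : h ≠ 0) :
    LinearMap.det (algebraMap ℝ (Module.End ℝ E) s - translation hT h) =
      LinearMap.det (algebraMap ℝ (Module.End ℝ E) s - translation hT 1) := by
  have hinv : dilation hS h hh * dilation hS h⁻¹ (inv_ne_zero hh) = 1 := by
    refine LinearMap.ext fun f => Subtype.ext (funext fun x => ?_)
    simp only [Module.End.mul_apply, dilation_apply, Module.End.one_apply]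
    rw [inv_mul_cancel_left₀ hh]
  have hdet : LinearMap.det (dilation hS h hh) ≠ 0 := by
    intro h0
    have := congrArg LinearMap.det hinv
    rw [map_mul, h0, zero_mul, map_one] at this
    exact zero_ne_one this
  have hcomm : dilation hS h hh * (algebraMap ℝ (Module.End ℝ E) s - translation hT h) =
      (algebraMap ℝ (Module.End ℝ E) s - translation hT 1) * dilation hS h hh := by
    refine LinearMap.ext fun f => Subtype.ext (funext fun x => ?_)
    have h1 : h * (x + 1) = h * x + h := by ring
    change s * (f : ℝ → ℝ) (h * x) - (f : ℝ → ℝ) (h * x + h) =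
      s * (f : ℝ → ℝ) (h * x) - (f : ℝ → ℝ) (h * (x + 1))
    rw [h1]
  have := congrArg LinearMap.det hcomm
  rw [map_mul, map_mul, mul_comm] at this
  exact mul_right_cancel₀ hdet this

/-- Basis coordinates are continuous for pointwise convergence because `E` is finite-dimensional, so
the matrix entries depend continuously on `h`. -/
theorem continuous_det_translation [FiniteDimensional ℝ E] (hE : ∀ f ∈ E, Continuous f) (s : ℝ) :
    Continuous fun h =>
      LinearMap.det (algebraMap ℝ (Module.End ℝ E) s - translation hT h) := by
  let b := Module.finBasis ℝ E
  simp_rw [← LinearMap.det_toMatrix b]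
  refine Continuous.matrix_det (continuous_matrix fun i j => ?_)
  simp_rw [LinearMap.toMatrix_apply]
  refine (b.coord i).continuous_of_finiteDimensional.comp ?_
  refine Continuous.subtype_mk (continuous_pi fun x => ?_) _
  change Continuous fun h => s * (b j : ℝ → ℝ) x - (b j : ℝ → ℝ) (x + h)
  have := hE _ (b j).2
  fun_prop

theorem translation_sub_one_pow_finrank_eq_zero [FiniteDimensional ℝ E]
    (hS : ∀ a : ℝ, a ≠ 0 → ∀ f ∈ E, (fun x => f (a * x)) ∈ E)
    (hE : ∀ f ∈ E, Continuous f) (h : ℝ) :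
    (translation hT h - 1) ^ Module.finrank ℝ E = 0 := by
  have h0 : translation hT 0 = 1 := by
    refine LinearMap.ext fun f => Subtype.ext (funext fun x => ?_)
    simp [translation_apply]
  have hdet (s : ℝ) : LinearMap.det (algebraMap ℝ (Module.End ℝ E) s - translation hT h) =
      (s - 1) ^ Module.finrank ℝ E := by
    -- Constancy for nonzero shifts extends to `0` by continuity, where translation is the identity.
    have hconst := Continuous.ext_on (dense_compl_singleton (0 : ℝ))
      (continuous_det_translation hT hE s)
      (continuous_const (y := LinearMap.det
        (algebraMap ℝ (Module.End ℝ E) s - translation hT 1)))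
      fun h hh => det_translation_eq hT hS s h hh
    have h1 : algebraMap ℝ (Module.End ℝ E) s - 1 = (s - 1) • (1 : Module.End ℝ E) := by
      refine LinearMap.ext fun f => Subtype.ext (funext fun x => ?_)
      change s * (f : ℝ → ℝ) x - (f : ℝ → ℝ) x = (s - 1) * (f : ℝ → ℝ) x
      ring
    rw [congrFun hconst h, ← congrFun hconst 0, h0, h1, LinearMap.det_smul, map_one, mul_one]
  have hchar : (translation hT h).charpoly =
      (Polynomial.X - Polynomial.C 1) ^ Module.finrank ℝ E := by
    refine Polynomial.funext fun s => ?_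
    rw [LinearMap.eval_charpoly, hdet]
    simp
  have := (translation hT h).aeval_self_charpoly
  rw [hchar] at this
  simpa using this

/-- A finite-dimensional space of continuous functions on `ℝ` that is invariant under translations
and dilations consists of polynomials. -/
theorem exists_polynomial_of_translation_dilation_invariant [FiniteDimensional ℝ E]
    (hT : ∀ h : ℝ, ∀ f ∈ E, (fun x => f (x + h)) ∈ E)
    (hS : ∀ a : ℝ, a ≠ 0 → ∀ f ∈ E, (fun x => f (a * x)) ∈ E)
    (hE : ∀ f ∈ E, Continuous f) {f : ℝ → ℝ} (hf : f ∈ E) :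
    ∃ p : Polynomial ℝ, ∀ x, f x = p.eval x := by
  refine (hE f hf).exists_polynomial_of_fwdDiff_iter_eq_zero (M := Module.finrank ℝ E) fun h => ?_
  have := translation_sub_one_pow_apply hT h (Module.finrank ℝ E) ⟨f, hf⟩
  rw [translation_sub_one_pow_finrank_eq_zero hT hS hE h] at this
  exact this.symm

end InvariantSpace

/-! ### Ridge functions and chains of neurons -/

/-- If a finite-dimensional space of functions on a set with nonempty interior contains all the
ridge functions `x ↦ ρ (a * x j + b)` in one coordinate direction, then `ρ` is a polynomial. -/
theorem exists_polynomial_of_ridge_mem_finiteDimensional {ι : Type*} [Fintype ι]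
    {Ω : Set (ι → ℝ)} (hΩ : (interior Ω).Nonempty) {ρ : ℝ → ℝ} (hρ : Continuous ρ) (j : ι)
    (A : Submodule ℝ (Ω → ℝ)) [FiniteDimensional ℝ A]
    (hA : ∀ a b : ℝ, (fun x : Ω => ρ (a * x.1 j + b)) ∈ A) :
    ∃ p : Polynomial ℝ, ∀ x, ρ x = p.eval x := by
  classical
  obtain ⟨z, hz⟩ := hΩ
  let g (p : ℝ × ℝ) (x : ℝ) : ℝ := ρ (p.1 * x + p.2)
  let E : Submodule ℝ (ℝ → ℝ) := Submodule.span ℝ (Set.range g)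
  have hgE (a b : ℝ) : (fun x => ρ (a * x + b)) ∈ E := Submodule.subset_span ⟨(a, b), rfl⟩
  have hT : ∀ h : ℝ, ∀ f ∈ E, (fun x => f (x + h)) ∈ E := by
    intro h
    change E ≤ E.comap (LinearMap.funLeft ℝ ℝ fun x : ℝ => x + h)
    refine Submodule.span_le.2 ?_
    rintro _ ⟨⟨a, b⟩, rfl⟩
    have h1 : (fun x => g (a, b) (x + h)) = fun x => ρ (a * x + (a * h + b)) := by
      funext x
      simp only [g, mul_add, add_assoc]
    change (fun x => g (a, b) (x + h)) ∈ E
    exact h1 ▸ hgE a (a * h + b)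
  have hS : ∀ a : ℝ, a ≠ 0 → ∀ f ∈ E, (fun x => f (a * x)) ∈ E := by
    intro c _
    change E ≤ E.comap (LinearMap.funLeft ℝ ℝ fun x : ℝ => c * x)
    refine Submodule.span_le.2 ?_
    rintro _ ⟨⟨a, b⟩, rfl⟩
    have h1 : (fun x => g (a, b) (c * x)) = fun x => ρ (a * c * x + b) := by
      funext x
      simp only [g, mul_assoc]
    change (fun x => g (a, b) (c * x)) ∈ E
    exact h1 ▸ hgE (a * c) b
  have hE : ∀ f ∈ E, Continuous f := by
    intro f hf
    induction hf using Submodule.span_induction with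
    | mem f hf => obtain ⟨p, rfl⟩ := hf; fun_prop
    | zero => exact continuous_zero
    | add f g _ _ hf hg => exact hf.add hg
    | smul c f _ hf => exact hf.const_smul c
  have : FiniteDimensional ℝ E := by
    refine finiteDimensional_of_finrank_restrict_le E (Module.finrank ℝ A) fun s => ?_
    -- A small `c` fits a scaled copy of `s` into `Ω` around `z`; the ridge parameters absorb the
    -- rescaling.
    obtain ⟨c, hc, hc0⟩ : ∃ c : ℝ, (∀ t ∈ s, z + Pi.single j (c * t) ∈ Ω) ∧ c ≠ 0 := by
      have h1 : ∀ᶠ c : ℝ in nhds 0, ∀ t ∈ s, z + Pi.single j (c * t) ∈ Ω := by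
        refine (Filter.eventually_all_finset s).2 fun t _ => ?_
        have h2 : Continuous fun c : ℝ => z + Pi.single (M := fun _ => ℝ) j (c * t) :=
          continuous_const.add ((continuous_single j).comp (continuous_mul_const t))
        refine h2.continuousAt ?_
        simpa using mem_interior_iff_mem_nhds.1 hz
      exact ((h1.filter_mono nhdsWithin_le_nhds).and
        (self_mem_nhdsWithin (a := (0 : ℝ)) (s := {0}ᶜ))).exists
    let P (t : s) : Ω := ⟨z + Pi.single j (c * t), hc t t.2⟩
    have hle : E.map (LinearMap.funLeft ℝ ℝ (Subtype.val : s → ℝ)) ≤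
        A.map (LinearMap.funLeft ℝ ℝ P) := by
      refine (Submodule.map_span_le _ _ _).2 ?_
      rintro _ ⟨⟨a, b⟩, rfl⟩
      refine ⟨_, hA (a / c) (b - a / c * z j), ?_⟩
      funext t
      simp only [LinearMap.funLeft_apply, g, P, Pi.add_apply, Pi.single_eq_same]
      congr 1
      field_simp
      ring
    exact (Submodule.finrank_mono hle).trans (Submodule.finrank_map_le _ _)
  refine exists_polynomial_of_translation_dilation_invariant hT hS hE ?_
  simpa using hgE 1 0

/-- The function computed by a chain of neurons with weights and biases given by `l`. -/
def neuronChain (ρ : ℝ → ℝ) (l : List (ℝ × ℝ)) (y : ℝ) : ℝ :=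
  l.foldl (fun y p => ρ (p.1 * y + p.2)) y

theorem neuronChain_cons (ρ : ℝ → ℝ) (p : ℝ × ℝ) (l : List (ℝ × ℝ)) (y : ℝ) :
    neuronChain ρ (p :: l) y = neuronChain ρ l (ρ (p.1 * y + p.2)) := rfl

theorem continuous_neuronChain {ρ : ℝ → ℝ} (hρ : Continuous ρ) (l : List (ℝ × ℝ)) :
    Continuous (neuronChain ρ l) := by
  induction l with
  | nil => exact continuous_id
  | cons p l ih => exact ih.comp (by fun_prop)

/-- A neuron with suitable weights approximates the identity. -/
theorem HasDerivAt.tendsto_neuron {ρ : ℝ → ℝ} {x₀ c : ℝ} (hd : HasDerivAt ρ c x₀) (hc : c ≠ 0)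
    (y : ℝ) : Filter.Tendsto
      (fun ε : ℝ => (ε * c)⁻¹ * ρ (ε * y + x₀) + -((ε * c)⁻¹ * ρ x₀)) (nhdsWithin 0 {0}ᶜ)
      (nhds y) := by
  have h1 : HasDerivAt (fun ε : ℝ => ρ (ε * y + x₀)) (c * y) 0 := by
    have h2 : HasDerivAt (fun ε : ℝ => ε * y + x₀) y 0 := by
      simpa using ((hasDerivAt_id (0 : ℝ)).mul_const y).add_const x₀
    have h3 : HasDerivAt ρ c (0 * y + x₀) := by simpa using hd
    exact h3.comp 0 h2
  have h4 := (hasDerivAt_iff_tendsto_slope_zero.1 h1).const_mul c⁻¹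
  rw [inv_mul_cancel_left₀ hc] at h4
  refine h4.congr fun ε => ?_
  simp only [zero_add, zero_mul, smul_eq_mul, mul_inv]
  ring

/-- A finite-dimensional space of functions containing all chains of `n + 1` neurons contains all
single neurons. -/
theorem neuron_mem_of_neuronChain_mem {X : Type*} {ρ : ℝ → ℝ} (hρ : Continuous ρ) {x₀ c : ℝ}
    (hd : HasDerivAt ρ c x₀) (hc : c ≠ 0) (A : Submodule ℝ (X → ℝ)) [FiniteDimensional ℝ A]
    (u : X → ℝ) (n : ℕ)
    (hA : ∀ l : List (ℝ × ℝ), l.length = n + 1 → (fun x => neuronChain ρ l (u x)) ∈ A) (a b : ℝ) :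
    (fun x => ρ (a * u x + b)) ∈ A := by
  induction n with
  | zero => exact hA [(a, b)] rfl
  | succ n ih =>
    refine ih fun l hl => ?_
    obtain ⟨p, l, rfl⟩ := List.exists_cons_of_length_eq_add_one hl
    have hclosed : IsClosed (A : Set (X → ℝ)) := A.closed_of_finiteDimensional
    -- The inserted first neuron and the affine part of the second together tend to the affine map
    -- of `p`.
    refine hclosed.mem_of_tendsto (b := nhdsWithin (0 : ℝ) {0}ᶜ)
      (f := fun ε x => neuronChain ρ
        ((ε * p.1, ε * p.2 + x₀) :: ((ε * c)⁻¹, -((ε * c)⁻¹ * ρ x₀)) :: l) (u x)) ?_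
      (Filter.Eventually.of_forall fun ε => hA _ (by simpa using hl))
    refine tendsto_pi_nhds.2 fun x => ?_
    have hcont : Continuous fun y => neuronChain ρ l (ρ y) := (continuous_neuronChain hρ l).comp hρ
    refine ((hcont.tendsto _).comp (hd.tendsto_neuron hc (p.1 * u x + p.2))).congr fun ε => ?_
    simp only [neuronChain_cons, Function.comp_apply]
    ring_nf

/-! ### Parameter dependence and chains inside networks -/

namespace NeuralNetwork

variable {L : ℕ} {N : Fin (L + 1) → ℕ}

theorem states_succ (ρ : ℝ → ℝ) (Φ : NeuralNetwork N) (x : Fin (N 0) → ℝ) (ℓ : Fin L) :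
    states ρ Φ x ℓ.succ = layer ρ Φ ℓ (states ρ Φ x ℓ.castSucc) := rfl

theorem states_congr (ρ : ℝ → ℝ) {Φ Ψ : NeuralNetwork N} (x : Fin (N 0) → ℝ) (k : Fin (L + 1))
    (h : ∀ ℓ : Fin L, ℓ.castSucc < k → Φ ℓ = Ψ ℓ) : states ρ Φ x k = states ρ Ψ x k := by
  induction k using Fin.induction with
  | zero => rfl
  | succ ℓ ih =>
    rw [states_succ, states_succ, ih fun m hm => h m (hm.trans ℓ.castSucc_lt_succ)]
    funext i
    simp only [layer, h ℓ ℓ.castSucc_lt_succ]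

/-- The normed space of the parameters of a network. -/
abbrev Parameters (N : Fin (L + 1) → ℕ) : Type :=
  (ℓ : Fin L) → (Fin (N ℓ.succ) → Fin (N ℓ.castSucc) → ℝ) × (Fin (N ℓ.succ) → ℝ)

/-- The network with given parameters. -/
def ofParameters (θ : Parameters N) : NeuralNetwork N :=
  fun ℓ => (Matrix.of (θ ℓ).1, (θ ℓ).2)

theorem ofParameters_surjective : Function.Surjective (ofParameters (N := N)) :=
  fun Φ => ⟨fun ℓ => ((Φ ℓ).1, (Φ ℓ).2), rfl⟩

theorem locallyLipschitz_states {ρ : ℝ → ℝ} (hρ : LocallyLipschitz ρ) (x : Fin (N 0) → ℝ)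
    (k : Fin (L + 1)) :
    LocallyLipschitz fun θ : Parameters N => states ρ (ofParameters θ) x k := by
  induction k using Fin.induction with
  | zero => exact LocallyLipschitz.const x
  | succ ℓ ih =>
    refine LocallyLipschitz.pi fun i => ?_
    have hG : ContDiff ℝ 1 fun q : Parameters N × (Fin (N ℓ.castSucc) → ℝ) =>
        ∑ j, (q.1 ℓ).1 i j * q.2 j + (q.1 ℓ).2 i := by
      have hℓ : ContDiff ℝ 1 fun q : Parameters N × (Fin (N ℓ.castSucc) → ℝ) => q.1 ℓ :=
        (ContinuousLinearMap.proj (R := ℝ) (φ := fun ℓ : Fin L =>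
          (Fin (N ℓ.succ) → Fin (N ℓ.castSucc) → ℝ) × (Fin (N ℓ.succ) → ℝ)) ℓ).contDiff.comp
            contDiff_fst
      refine (ContDiff.sum fun j _ => ContDiff.mul ?_ ?_).add ?_
      · exact contDiff_pi.1 (contDiff_pi.1 hℓ.fst i) j
      · exact contDiff_pi.1 contDiff_snd j
      · exact contDiff_pi.1 hℓ.snd i
    have haff := hG.locallyLipschitz.comp (LocallyLipschitz.id.prodMk ih)
    simp only [states_succ, layer]
    split_ifs
    · exact hρ.comp haff
    · exact haff

/-- The network whose layers are neurons with weights and biases given by `l`, attached to the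
zeroth component of the previous layer, and the zeroth component itself from then on. -/
def ofChain (N : Fin (L + 1) → ℕ) (l : List (ℝ × ℝ)) : NeuralNetwork N :=
  fun ℓ => (Matrix.of fun _ j => if (j : ℕ) = 0 then (l.getD ℓ (1, 0)).1 else 0,
    fun _ => (l.getD ℓ (1, 0)).2)

theorem ofChain_mulVec_add (l : List (ℝ × ℝ)) (ℓ : Fin L) (v : Fin (N ℓ.castSucc) → ℝ)
    (hN : 0 < N ℓ.castSucc) (i : Fin (N ℓ.succ)) :
    ((ofChain N l ℓ).1.mulVec v + (ofChain N l ℓ).2) i =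
      (l.getD ℓ (1, 0)).1 * v ⟨0, hN⟩ + (l.getD ℓ (1, 0)).2 := by
  rw [Pi.add_apply]
  congr 1
  change ∑ j : Fin (N ℓ.castSucc), (if (j : ℕ) = 0 then (l.getD ℓ (1, 0)).1 else 0) * v j = _
  rw [Finset.sum_eq_single ⟨0, hN⟩]
  · rw [if_pos rfl]
  · intro j _ hj
    rw [if_neg fun h => hj (Fin.ext h), zero_mul]
  · simp

theorem states_ofChain (ρ : ℝ → ℝ) (hN : ∀ k, 0 < N k) (l : List (ℝ × ℝ)) (hl : l.length + 1 = L)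
    (x : Fin (N 0) → ℝ) (k : Fin (L + 1)) (hk : (k : ℕ) ≤ l.length) :
    states ρ (ofChain N l) x k ⟨0, hN k⟩ = neuronChain ρ (l.take k) (x ⟨0, hN 0⟩) := by
  induction k using Fin.induction with
  | zero => simp [neuronChain, states]
  | succ ℓ ih =>
    have hℓ : (ℓ : ℕ) < l.length := by simpa using hk
    rw [states_succ, layer, if_pos (by omega), ofChain_mulVec_add _ _ _ (hN _),
      ih (by simpa using hℓ.le), Fin.val_succ, List.take_succ_eq_append_getElem hℓ,
      List.getD_eq_getElem _ _ hℓ, neuronChain, neuronChain, List.foldl_append]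
    rfl

theorem states_ofChain_last (ρ : ℝ → ℝ) (hN : ∀ k, 0 < N k) (l : List (ℝ × ℝ))
    (hl : l.length + 1 = L) (x : Fin (N 0) → ℝ) :
    states ρ (ofChain N l) x (Fin.last L) ⟨0, hN _⟩ = neuronChain ρ l (x ⟨0, hN 0⟩) := by
  subst hl
  have h := states_ofChain ρ hN l rfl x (Fin.last l.length).castSucc (by simp)
  -- The last layer lies past the end of `l`, so the default `(1, 0)` makes it copy its input.
  rw [← Fin.succ_last, states_succ, layer, if_neg (by simp), ofChain_mulVec_add _ _ _ (hN _), h]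
  simp

end NeuralNetwork

/-! ### Linearity of the realization set and conclusion -/

open NeuralNetwork

theorem smul_mem_realizationSet {L : ℕ} (hL : 0 < L) {N : Fin (L + 1) → ℕ} {ρ : ℝ → ℝ}
    {Ω : Set (Fin (N 0) → ℝ)} {f : Ω → Fin (N (Fin.last L)) → ℝ} (hf : f ∈ realizationSet N ρ Ω)
    (c : ℝ) : c • f ∈ realizationSet N ρ Ω := by
  obtain ⟨n, rfl⟩ : ∃ n, L = n + 1 := ⟨L - 1, by omega⟩
  obtain ⟨Φ, rfl⟩ := hf
  let Ψ : NeuralNetwork N := Function.update Φ (Fin.last n) (c • Φ (Fin.last n))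
  refine ⟨Ψ, funext fun x => ?_⟩
  have hstates : states ρ Ψ x (Fin.last n).castSucc = states ρ Φ x (Fin.last n).castSucc := by
    refine states_congr ρ _ _ fun ℓ hℓ => Function.update_of_ne ?_ _ _
    exact (Fin.castSucc_lt_castSucc_iff.1 hℓ).ne
  have hlast : Ψ (Fin.last n) = c • Φ (Fin.last n) := Function.update_self _ _ _
  change states ρ Ψ x (Fin.last n).succ = c • states ρ Φ x (Fin.last n).succ
  funext i
  rw [Pi.smul_apply, states_succ, states_succ, hstates, layer, layer, if_neg (by simp),
    if_neg (by simp), hlast, Prod.smul_fst, Prod.smul_snd, Matrix.smul_mulVec, ← smul_add,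
    Pi.smul_apply]

/-- A convex set of realizations is a linear subspace. -/
def realizationSubmodule {L : ℕ} (hL : 0 < L) (N : Fin (L + 1) → ℕ) (ρ : ℝ → ℝ)
    (Ω : Set (Fin (N 0) → ℝ)) (hconv : Convex ℝ (realizationSet N ρ Ω)) :
    Submodule ℝ (Ω → Fin (N (Fin.last L)) → ℝ) where
  carrier := realizationSet N ρ Ω
  add_mem' {f g} hf hg := by
    have h := smul_mem_realizationSet hL
      (hconv hf hg (show (0 : ℝ) ≤ 1 / 2 by norm_num) (show (0 : ℝ) ≤ 1 / 2 by norm_num)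
        (by norm_num)) 2
    rw [smul_add, smul_smul, smul_smul] at h
    norm_num at h
    exact h
  zero_mem' := by
    have h := smul_mem_realizationSet hL
      (Set.mem_range_self (f := realization ρ Ω) (fun _ => 0 : NeuralNetwork N)) 0
    rwa [zero_smul] at h
  smul_mem' c _ hf := smul_mem_realizationSet hL hf c

theorem theorem2p1 (L : ℕ) (hL : 2 ≤ L) (N : Fin (L + 1) → ℕ) (hN : ∀ ℓ, 1 ≤ N ℓ)
    (Ω : Set (Fin (N 0) → ℝ)) (hΩ : (interior Ω).Nonempty)
    (ρ : ℝ → ℝ) (hρ : LocallyLipschitz ρ)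
    (hconv : Convex ℝ (realizationSet N ρ Ω)) :
    ∃ p : Polynomial ℝ, ∀ x : ℝ, ρ x = p.eval x := by
  by_cases hconst : ∀ x, ρ x = ρ 0
  · exact ⟨Polynomial.C (ρ 0), fun x => by rw [hconst, Polynomial.eval_C]⟩
  push Not at hconst
  obtain ⟨x₁, hx₁⟩ := hconst
  obtain ⟨x₀, hx₀⟩ := hρ.exists_deriv_ne_zero hx₁
  let i₀ : Fin (N (Fin.last L)) := ⟨0, hN _⟩
  let A : Submodule ℝ (Ω → ℝ) := (realizationSubmodule (by omega) N ρ Ω hconv).map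
    ((LinearMap.proj i₀ : (Fin (N (Fin.last L)) → ℝ) →ₗ[ℝ] ℝ).compLeft Ω)
  have hmem (Φ : NeuralNetwork N) : (fun x : Ω => states ρ Φ x (Fin.last L) i₀) ∈ A :=
    ⟨realization ρ Ω Φ, ⟨Φ, rfl⟩, rfl⟩
  have : FiniteDimensional ℝ A := by
    refine finiteDimensional_of_finrank_restrict_le A (Module.finrank ℝ (Parameters N)) fun s => ?_
    refine LocallyLipschitz.finrank_le_of_range_eq
      (g := fun θ : Parameters N => fun x : s => states ρ (ofParameters θ) x.1.1 (Fin.last L) i₀)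
      (LocallyLipschitz.pi fun x => ?_) (Set.Subset.antisymm ?_ ?_)
    · exact (LipschitzWith.eval i₀).locallyLipschitz.comp (locallyLipschitz_states hρ x.1.1 _)
    · rintro _ ⟨θ, rfl⟩
      exact ⟨_, hmem (ofParameters θ), rfl⟩
    · rintro _ ⟨_, ⟨_, ⟨Φ, rfl⟩, rfl⟩, rfl⟩
      obtain ⟨θ, rfl⟩ := ofParameters_surjective Φ
      exact ⟨θ, rfl⟩
  refine exists_polynomial_of_ridge_mem_finiteDimensional hΩ hρ.continuous ⟨0, hN 0⟩ A ?_
  -- The last layer has no activation, so chains have `L - 1 = (L - 2) + 1` neurons.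
  refine neuron_mem_of_neuronChain_mem hρ.continuous
    (differentiableAt_of_deriv_ne_zero hx₀).hasDerivAt hx₀ A _ (L - 2) fun l hl => ?_
  have h := hmem (ofChain N l)
  simp only [i₀, states_ofChain_last ρ hN l (by omega)] at h
  exact h
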